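/- **Theorem (Shape regularity).** Let $n\ge 1$. A tagged $n$-simplex $T=[v_0,\dots,v_n]_\gamma$ consists of an ordered array of $n+1$ affinely independent points $v_0,\dots,v_n\in\mathbb{R}^n$ and a tag $\gamma\in\{1,\dots,n\}$; as a set, $T$ is the convex hull of its vertices. Its bisection produces the two tagged children $$T_1=[v_0,v_1,\dots,v_{\gamma-1},v',v_{\gamma+1},\dots,v_n]_{\gamma'},\qquad T_2=[v_1,v_2,\dots,v_\gamma,v',v_{\gamma+1},\dots,v_n]_{\gamma'},$$ where $v'=(v_0+v_\gamma)/2$, and $\gamma'=\gamma-1$ if $\gamma\ge 2$, $\gamma'=n$ if $\gamma=1$. A descendant of a tagged simplex $T_0$ is any tagged simplex obtained from $T_0$ by finitely many (possibly zero) steps, each passing from a tagged simplex to one of its two children. For an $n$-simplex $T\subset\mathbb{R}^n$ let $r(T)$ be the diameter of the largest closed ball contained in $T$, let $R(T)$ be the diameter of the smallest closed ball containing $T$, and let $\gamma(T)=R(T)/r(T)$ be its shape regularity. Then every descendant $T$ of every tagged $n$-simplex $T_0$ satisfies $$\gamma(T)\le 2n\,(n+\sqrt2-1)\,\gamma(T_0).$$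 -/

import Mathlib

noncomputable section

namespace Maubach

/-- The diameter `r(S)` of the largest closed ball contained in `S ⊆ ℝⁿ`. -/
def inballDiam {n : ℕ} (S : Set (EuclideanSpace ℝ (Fin n))) : ℝ :=
  sSup {d : ℝ | ∃ (c : EuclideanSpace ℝ (Fin n)) (ρ : ℝ),
    0 ≤ ρ ∧ Metric.closedBall c ρ ⊆ S ∧ d = 2 * ρ}

/-- The diameter `R(S)` of the smallest closed ball containing `S ⊆ ℝⁿ`. -/
def circumballDiam {n : ℕ} (S : Set (EuclideanSpace ℝ (Fin n))) : ℝ :=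
  sInf {d : ℝ | ∃ (c : EuclideanSpace ℝ (Fin n)) (ρ : ℝ),
    0 ≤ ρ ∧ S ⊆ Metric.closedBall c ρ ∧ d = 2 * ρ}

/-- The shape regularity `γ(S) = R(S) / r(S)`. -/
def shapeRegularity {n : ℕ} (S : Set (EuclideanSpace ℝ (Fin n))) : ℝ :=
  circumballDiam S / inballDiam S

/-- A tagged `n`-simplex `[v₀, …, vₙ]_γ` in `ℝⁿ`: an array of `n + 1` affinely independent
points together with a tag `γ ∈ {1, …, n}`. -/
structure TaggedSimplex (n : ℕ) extends
    Affine.Simplex ℝ (EuclideanSpace ℝ (Fin n)) n where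
  tag : ℕ
  one_le_tag : 1 ≤ tag
  tag_le : tag ≤ n

namespace TaggedSimplex

variable {n : ℕ}

/-- The simplex as a set: the convex hull of its vertices. -/
def toSet (T : TaggedSimplex n) : Set (EuclideanSpace ℝ (Fin n)) :=
  convexHull ℝ (Set.range T.points)

/-- The tag, as an index of a vertex. -/
def tagIndex (T : TaggedSimplex n) : Fin (n + 1) :=
  ⟨T.tag, Nat.lt_succ_of_le T.tag_le⟩

/-- The bisection vertex `v' = (v₀ + v_γ) / 2`. -/
def bisectionVertex (T : TaggedSimplex n) : EuclideanSpace ℝ (Fin n) :=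
  midpoint ℝ (T.points 0) (T.points T.tagIndex)

/-- The new tag: `γ - 1` if `γ ≥ 2`, and `n` otherwise. -/
def newTag (T : TaggedSimplex n) : ℕ :=
  if 2 ≤ T.tag then T.tag - 1 else n

/-- The array `v₀, v₁, …, v_{γ-1}, v', v_{γ+1}, …, vₙ`. -/
def firstPoints (T : TaggedSimplex n) (i : Fin (n + 1)) : EuclideanSpace ℝ (Fin n) :=
  if (i : ℕ) = T.tag then T.bisectionVertex else T.points i

/-- The array `v₁, v₂, …, v_γ, v', v_{γ+1}, …, vₙ`. -/
def secondPoints (T : TaggedSimplex n) (i : Fin (n + 1)) : EuclideanSpace ℝ (Fin n) :=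
  if h : (i : ℕ) < T.tag then T.points ⟨(i : ℕ) + 1, by have := T.tag_le; omega⟩
  else if (i : ℕ) = T.tag then T.bisectionVertex else T.points i

theorem one_le_newTag (T : TaggedSimplex n) : 1 ≤ T.newTag := by
  have h1 := T.one_le_tag
  have h2 := T.tag_le
  unfold newTag
  split_ifs <;> omega

theorem newTag_le (T : TaggedSimplex n) : T.newTag ≤ n := by
  have h2 := T.tag_le
  unfold newTag
  split_ifs <;> omega

theorem tagIndex_ne_zero (T : TaggedSimplex n) : T.tagIndex ≠ 0 := by
  have h1 := T.one_le_tag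
  intro h
  have := congrArg Fin.val h
  simp [tagIndex] at this
  omega

/-- Replacing one of two distinct vertices of an affinely independent family by the midpoint of
the two preserves affine independence. -/
theorem affineIndependent_update_midpoint {ι V : Type*} [Fintype ι] [DecidableEq ι]
    [AddCommGroup V] [Module ℝ V] {p : ι → V} (hp : AffineIndependent ℝ p) {a b : ι}
    (hab : a ≠ b) : AffineIndependent ℝ (Function.update p b (midpoint ℝ (p a) (p b))) := by
  rw [affineIndependent_iff_of_fintype] at hp ⊢
  intro w hw hs
  rw [Finset.weightedVSub_eq_linear_combination _ hw] at hs
  set u : ι → ℝ := w + Pi.single a (w b / 2) - Pi.single b (w b / 2) with hu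
  have hu0 : ∑ i, u i = 0 := by
    simp [hu, Finset.sum_add_distrib, Finset.sum_sub_distrib, hw]
  have key : ∑ i, u i • p i = ∑ i, w i • Function.update p b (midpoint ℝ (p a) (p b)) i := by
    have h1 : ∀ i, w i • Function.update p b (midpoint ℝ (p a) (p b)) i
        = w i • p i + (Pi.single b (w b • (midpoint ℝ (p a) (p b) - p b)) : ι → V) i := by
      intro i
      by_cases h : i = b
      · subst h; simp only [Function.update_self, Pi.single_eq_same]; module
      · simp [h]
    have h2 : ∀ (c : ι) (t : ℝ) (i : ι), (Pi.single c t : ι → ℝ) i • p i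
        = (Pi.single c (t • p c) : ι → V) i := by
      intro c t i
      by_cases h : i = c
      · subst h; simp
      · simp [h]
    simp only [h1, hu, Pi.add_apply, Pi.sub_apply, add_smul, sub_smul, h2,
      Finset.sum_add_distrib, Finset.sum_sub_distrib, Finset.sum_pi_single',
      Finset.mem_univ, if_true]
    simp only [midpoint_eq_smul_add, invOf_eq_inv]
    module
  have hz := hp u hu0 (by
    rw [Finset.weightedVSub_eq_linear_combination _ hu0, key, hs])
  have hb : w b = 0 := by
    have := hz b
    simp [hu, hab.symm] at this
    linarith
  intro i
  have := hz i
  simpa [hu, hb] using this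

theorem firstPoints_eq (T : TaggedSimplex n) :
    T.firstPoints = Function.update T.points T.tagIndex T.bisectionVertex := by
  funext i
  by_cases h : i = T.tagIndex
  · subst h; simp [firstPoints, tagIndex]
  · have : (i : ℕ) ≠ T.tag := fun h' => h (Fin.ext h')
    simp [firstPoints, h, this]

theorem affineIndependent_firstPoints (T : TaggedSimplex n) :
    AffineIndependent ℝ T.firstPoints := by
  rw [firstPoints_eq]
  exact affineIndependent_update_midpoint T.independent T.tagIndex_ne_zero.symm

theorem affineIndependent_secondPoints (T : TaggedSimplex n) :
    AffineIndependent ℝ T.secondPoints := by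
  have h := affineIndependent_update_midpoint T.independent T.tagIndex_ne_zero
  rw [midpoint_comm] at h
  have htag := T.tag_le
  have h1tag := T.one_le_tag
  let e : Fin (n + 1) → Fin (n + 1) := fun i =>
    if h : (i : ℕ) < T.tag then ⟨(i : ℕ) + 1, by omega⟩
    else if (i : ℕ) = T.tag then 0 else i
  have he : Function.Injective e := by
    intro i j hij
    have := congrArg Fin.val hij
    simp only [e] at this
    apply Fin.ext
    split_ifs at this <;> (try simp only [Fin.val_zero] at this) <;> omega
  have heq : T.secondPoints = Function.update T.points 0
      (midpoint ℝ (T.points 0) (T.points T.tagIndex)) ∘ (⟨e, he⟩ : Fin (n + 1) ↪ Fin (n + 1)) := ?_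
  · rw [heq]
    exact h.comp_embedding ⟨e, he⟩
  funext i
  simp only [secondPoints, Function.comp, Function.Embedding.coeFn_mk, e]
  split_ifs with h1 h2
  · rw [Function.update_of_ne]
    intro h0
    simpa using congrArg Fin.val h0
  · simp [bisectionVertex]
  · rw [Function.update_of_ne]
    intro h0
    have := congrArg Fin.val h0
    simp only [Fin.val_zero] at this
    omega

/-- The child `[v₀, v₁, …, v_{γ-1}, v', v_{γ+1}, …, vₙ]_{γ'}`. -/
def firstChild (T : TaggedSimplex n) : TaggedSimplex n where
  points := T.firstPoints
  independent := T.affineIndependent_firstPoints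
  tag := T.newTag
  one_le_tag := T.one_le_newTag
  tag_le := T.newTag_le

/-- The child `[v₁, v₂, …, v_γ, v', v_{γ+1}, …, vₙ]_{γ'}`. -/
def secondChild (T : TaggedSimplex n) : TaggedSimplex n where
  points := T.secondPoints
  independent := T.affineIndependent_secondPoints
  tag := T.newTag
  one_le_tag := T.one_le_newTag
  tag_le := T.newTag_le

/-- `T'` is one of the two children produced by one bisection of `T`. -/
def IsChild (T T' : TaggedSimplex n) : Prop :=
  T' = T.firstChild ∨ T' = T.secondChild

/-- `T` results from `T₀` by finitely many (possibly zero) successive bisections. -/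
def IsDescendant (T₀ T : TaggedSimplex n) : Prop :=
  Relation.ReflTransGen IsChild T₀ T

end TaggedSimplex

end Maubach

end

namespace Maubach

open Finset

namespace TaggedSimplex

variable {n : ℕ}

/-! Up to the factor 1/2 beyond the tag, the vertices of a tagged simplex are scaled partial sums of
`n` steps. Bisection respects this form: the first child keeps the steps, the second permutes them
cyclically below the tag and reverses one, and the scale `h` halves when the tag wraps from 1 to
`n`. So every descendant is built from the steps of `T₀` up to order, sign and scale
(`IsDescendant.exists_isPath`).

What survives is metric information on single steps: with `D = R(T₀)`, a step has length at most `κ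
j * D`; and since `T₀` lies in the parallelotope with sides `1 / κ j`, a ball of radius `ρ` in `T₀`
bounds the coordinates of short vectors. With `z j = stepSize T.tag j * κ j`, this yields a ball
around `T` of radius `h / 2 * (∑ z) * D` and a ball inside `T` of radius `ρ * h / ∑ 1 / z`. As `z`
takes only the values 1/2, 1, 2, the product of the two sums is at most `25 / 16 * n ^ 2`, which is
below the claimed constant. -/

/-- The vertices of `T` are the partial sums of the steps `d`, scaled by `h` up to the tag and
by `h / 2` beyond it, seen from the base point `w`. -/
def IsPath (T : TaggedSimplex n) (w : EuclideanSpace ℝ (Fin n)) (h : ℝ)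
    (d : ℕ → EuclideanSpace ℝ (Fin n)) : Prop :=
  ∀ i : Fin (n + 1), T.points i =
    w + (if (i : ℕ) ≤ T.tag then h else h / 2) • ∑ j ∈ range i, d j

/-- The steps `d` have lengths at most `κ j * D`, and every vector of length at most `ρ` has
coordinates at most `1 / (2 * κ j)` with respect to them. -/
structure StepBounds (n : ℕ) (D ρ : ℝ) (d : ℕ → EuclideanSpace ℝ (Fin n)) (κ : ℕ → ℝ) :
    Prop where
  eq_one_or_two : ∀ j < n, κ j = 1 ∨ κ j = 2
  norm_le : ∀ j < n, ‖d j‖ ≤ κ j * D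
  exists_coord : ∀ u, ‖u‖ ≤ ρ → ∃ t : ℕ → ℝ,
    (∀ j < n, |t j| ≤ 1 / (2 * κ j)) ∧ ∑ j ∈ range n, t j • d j = u

/-! ### Signed cyclic shifts of the steps -/

/-- The cyclic shift of `{0, …, g - 1}`, fixing all other numbers. -/
def shift (g j : ℕ) : ℕ := if j + 1 < g then j + 1 else if j + 1 = g then 0 else j

/-- The sign with which the shifted steps are traversed in the second child. -/
def shiftSign (g j : ℕ) : ℝ := if j + 1 = g then -1 else 1

theorem shift_lt {g j m : ℕ} (hg : g ≤ m) (hj : j < m) : shift g j < m := by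
  unfold shift; split_ifs <;> omega

theorem abs_shiftSign (g j : ℕ) : |shiftSign g j| = 1 := by
  unfold shiftSign; split_ifs <;> simp

theorem shiftSign_mul_self (g j : ℕ) : shiftSign g j * shiftSign g j = 1 := by
  unfold shiftSign; split_ifs <;> simp

theorem sum_range_shift_of_lt {M : Type*} [AddCommGroup M] (f : ℕ → M) {g i : ℕ} (hi : i < g) :
    ∑ j ∈ range i, f (shift g j) = ∑ j ∈ range (i + 1), f j - f 0 := by
  rw [sum_range_succ', add_sub_cancel_right]
  refine sum_congr rfl fun j hj => ?_
  have := mem_range.1 hj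
  rw [shift, if_pos (by omega)]

theorem sum_range_shift {M : Type*} [AddCommGroup M] (f : ℕ → M) {g i : ℕ} (hg : 1 ≤ g)
    (hi : g ≤ i) : ∑ j ∈ range i, f (shift g j) = ∑ j ∈ range i, f j := by
  induction i, hi using Nat.le_induction with
  | base =>
    obtain ⟨k, rfl⟩ : ∃ k, g = k + 1 := ⟨g - 1, by omega⟩
    rw [sum_range_succ, sum_range_shift_of_lt f (Nat.lt_succ_self k)]
    simp [shift]
  | succ i hi ih =>
    rw [sum_range_succ, sum_range_succ, ih, shift, if_neg (by omega), if_neg (by omega)]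

theorem sum_range_shiftSign_of_lt {M : Type*} [AddCommGroup M] [Module ℝ M] (f : ℕ → M)
    {g i : ℕ} (hi : i < g) :
    ∑ j ∈ range i, shiftSign g j • f (shift g j) = ∑ j ∈ range (i + 1), f j - f 0 := by
  rw [← sum_range_shift_of_lt f hi]
  refine sum_congr rfl fun j hj => ?_
  have := mem_range.1 hj
  rw [shiftSign, if_neg (by omega), one_smul]

/-- Once the whole cycle is traversed, only the reversal of step 0 is felt, and it costs `2 • f 0`.
-/
theorem sum_range_shiftSign {M : Type*} [AddCommGroup M] [Module ℝ M] (f : ℕ → M)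
    {g i : ℕ} (hg : 1 ≤ g) (hi : g ≤ i) :
    ∑ j ∈ range i, shiftSign g j • f (shift g j) = ∑ j ∈ range i, f j - (2 : ℝ) • f 0 := by
  induction i, hi using Nat.le_induction with
  | base =>
    obtain ⟨k, rfl⟩ : ∃ k, g = k + 1 := ⟨g - 1, by omega⟩
    rw [sum_range_succ, sum_range_shiftSign_of_lt f (Nat.lt_succ_self k)]
    simp only [shift, shiftSign, lt_irrefl, if_true, if_false]
    module
  | succ i hi ih =>
    rw [sum_range_succ, sum_range_succ, ih, shift, shiftSign, if_neg (by omega),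
      if_neg (by omega), if_neg (by omega)]
    module

theorem StepBounds.shift {D ρ : ℝ} {d : ℕ → EuclideanSpace ℝ (Fin n)} {κ : ℕ → ℝ}
    (H : StepBounds n D ρ d κ) {g : ℕ} (hg : 1 ≤ g) (hgn : g ≤ n) :
    StepBounds n D ρ (fun j => shiftSign g j • d (shift g j)) (fun j => κ (shift g j)) where
  eq_one_or_two j hj := H.eq_one_or_two _ (shift_lt hgn hj)
  norm_le j hj := by
    rw [norm_smul, Real.norm_eq_abs, abs_shiftSign, one_mul]
    exact H.norm_le _ (shift_lt hgn hj)
  exists_coord u hu := by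
    obtain ⟨t, ht, rfl⟩ := H.exists_coord u hu
    refine ⟨fun j => shiftSign g j * t (TaggedSimplex.shift g j), fun j hj => ?_, ?_⟩
    · rw [abs_mul, abs_shiftSign, one_mul]
      exact ht _ (shift_lt hgn hj)
    · rw [← sum_range_shift (fun j => t j • d j) hg hgn]
      refine sum_congr rfl fun j _ => ?_
      rw [smul_smul, mul_right_comm, shiftSign_mul_self, one_mul]

/-! ### Bisection in terms of paths -/

section Children

variable {T : TaggedSimplex n} {w : EuclideanSpace ℝ (Fin n)} {h : ℝ}
  {d : ℕ → EuclideanSpace ℝ (Fin n)}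

theorem IsPath.bisectionVertex_eq (H : T.IsPath w h d) :
    T.bisectionVertex = w + (h / 2) • ∑ j ∈ range T.tag, d j := by
  rw [bisectionVertex, H, H, midpoint_eq_smul_add, invOf_eq_inv]
  simp only [tagIndex, Fin.val_zero, range_zero, sum_empty, smul_zero, le_refl, if_true]
  module

theorem IsPath.firstChild (H : T.IsPath w h d) :
    T.firstChild.IsPath w (if 2 ≤ T.tag then h else h / 2) d := by
  intro i
  change T.firstPoints i = w + (if (i : ℕ) ≤ T.newTag then _ else _) • _
  have h1 := T.one_le_tag
  have hi := i.is_le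
  unfold firstPoints newTag
  rcases lt_trichotomy (i : ℕ) T.tag with hit | hit | hit
  · rw [if_neg hit.ne, H, if_pos hit.le]
    split_ifs
    · rfl
    · omega
    -- When the tag is 1, only vertex 0 precedes it; its sum is empty, so halving the scale does not
    -- move it.
    · have : (i : ℕ) = 0 := by omega
      simp [this]
  · rw [if_pos hit, H.bisectionVertex_eq, hit]
    split_ifs
    · omega
    · rfl
    · rfl
    · omega
  · rw [if_neg hit.ne', H, if_neg hit.not_ge]
    split_ifs
    · omega
    · rfl
    · rfl

/-- The path now starts at `v₁ = w + h • d 0` and runs through the remaining steps below the tag.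
Appending `-d 0` and halving the scale then leads to the bisection vertex. -/
theorem IsPath.secondChild (H : T.IsPath w h d) :
    T.secondChild.IsPath (w + h • d 0) (if 2 ≤ T.tag then h else h / 2)
      (fun j => shiftSign T.tag j • d (shift T.tag j)) := by
  intro i
  change T.secondPoints i = w + h • d 0 + (if (i : ℕ) ≤ T.newTag then _ else _) • _
  have h1 := T.one_le_tag
  have hi := i.is_le
  unfold secondPoints newTag
  rcases lt_trichotomy (i : ℕ) T.tag with hit | hit | hit
  · rw [dif_pos hit, H, sum_range_shiftSign_of_lt d hit]
    simp only [if_pos (Nat.succ_le_of_lt hit)]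
    split_ifs
    · module
    · omega
    · have : (i : ℕ) = 0 := by omega
      simp [this]
  · rw [dif_neg hit.not_lt, if_pos hit, H.bisectionVertex_eq, hit,
      sum_range_shiftSign d h1 le_rfl]
    split_ifs
    · omega
    · module
    · module
    · omega
  · rw [dif_neg hit.not_gt, if_neg hit.ne', H, if_neg hit.not_ge,
      sum_range_shiftSign d h1 hit.le]
    split_ifs
    · omega
    · module
    · module

end Children

theorem IsDescendant.exists_isPath {T₀ T : TaggedSimplex n} (hT : IsDescendant T₀ T)
    {w : EuclideanSpace ℝ (Fin n)} {h D ρ : ℝ} {d : ℕ → EuclideanSpace ℝ (Fin n)} {κ : ℕ → ℝ}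
    (hh : 0 < h) (H : T₀.IsPath w h d) (B : StepBounds n D ρ d κ) :
    ∃ w' h' d' κ', 0 < h' ∧ T.IsPath w' h' d' ∧ StepBounds n D ρ d' κ' := by
  induction hT with
  | refl => exact ⟨w, h, d, κ, hh, H, B⟩
  | tail _ hc ih =>
    obtain ⟨w', h', d', κ', hh', H', B'⟩ := ih
    have hpos : ∀ k : ℕ, 0 < if 2 ≤ k then h' else h' / 2 := fun k => by
      split_ifs <;> positivity
    rcases hc with rfl | rfl
    · exact ⟨_, _, _, _, hpos _, H'.firstChild, B'⟩
    · exact ⟨_, _, _, _, hpos _, H'.secondChild, B'.shift (one_le_tag _) (tag_le _)⟩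


/-! ### Steps of the initial simplex -/

section Initial

variable (T : TaggedSimplex n)

/-- The vertices of `T` seen from the first one, doubled beyond the tag. -/
def pathVertex (i : ℕ) : EuclideanSpace ℝ (Fin n) :=
  (if i ≤ T.tag then (1 : ℝ) else 2) • (T.points (Fin.ofNat (n + 1) i) - T.points 0)

/-- The steps of the path along which the vertices of `T` lie. -/
def pathStep (j : ℕ) : EuclideanSpace ℝ (Fin n) := T.pathVertex (j + 1) - T.pathVertex j

/-- The bounds on the lengths of the steps `T.pathStep`. -/
def pathWeight (j : ℕ) : ℝ := if j < T.tag then 1 else 2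

theorem sum_pathStep (i : ℕ) : ∑ j ∈ range i, T.pathStep j = T.pathVertex i := by
  have : T.pathVertex 0 = 0 := by simp [pathVertex]
  simp only [pathStep, sum_range_sub, this, sub_zero]

theorem isPath_pathStep : T.IsPath (T.points 0) 1 T.pathStep := by
  intro i
  have hi : Fin.ofNat (n + 1) (i : ℕ) = i := Fin.ext (Nat.mod_eq_of_lt i.is_lt)
  rw [sum_pathStep, pathVertex, hi]
  split_ifs <;> module

theorem pathWeight_pos (j : ℕ) : 0 < T.pathWeight j := by
  unfold pathWeight; split_ifs <;> norm_num

theorem norm_pathStep_le {D : ℝ} (hD : ∀ i j, ‖T.points i - T.points j‖ ≤ D) (j : ℕ) :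
    ‖T.pathStep j‖ ≤ T.pathWeight j * D := by
  set P : ℕ → EuclideanSpace ℝ (Fin n) := fun i => T.points (Fin.ofNat (n + 1) i) with hP
  have hPD : ∀ i j, ‖P i - P j‖ ≤ D := fun i j => hD _ _
  have hP0 : ∀ i, ‖P i - T.points 0‖ ≤ D := fun i => hD _ _
  unfold pathStep pathWeight pathVertex
  rcases lt_trichotomy j T.tag with hj | hj | hj
  · rw [if_pos (Nat.succ_le_of_lt hj), if_pos hj.le, if_pos hj, one_mul, one_smul, one_smul,
      sub_sub_sub_cancel_right]
    exact hD _ _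
  -- Only this step crosses the tag, where the doubling sets in; it is the sum of two edge vectors.
  · rw [if_neg (by omega), if_pos hj.le, if_neg (by omega), one_smul]
    calc ‖(2 : ℝ) • (P (j + 1) - T.points 0) - (P j - T.points 0)‖
        = ‖(P (j + 1) - T.points 0) + (P (j + 1) - P j)‖ := by congr 1; module
      _ ≤ D + D := (norm_add_le _ _).trans (add_le_add (hP0 _) (hPD _ _))
      _ = 2 * D := by ring
  · rw [if_neg (by omega), if_neg (by omega), if_neg (by omega), ← smul_sub,
      sub_sub_sub_cancel_right, norm_smul, Real.norm_two]
    exact mul_le_mul_of_nonneg_left (hD _ _) zero_le_two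

/-- The points with such coordinates form a convex set, so only the vertices need checking: their
coordinates are 0 and either 1 (up to the tag) or 1/2 (beyond it). -/
theorem exists_coord_of_mem_toSet {x : EuclideanSpace ℝ (Fin n)} (hx : x ∈ T.toSet) :
    ∃ s : ℕ → ℝ, (∀ j < n, 0 ≤ s j ∧ s j ≤ 1 / T.pathWeight j) ∧
      T.points 0 + ∑ j ∈ range n, s j • T.pathStep j = x := by
  revert x
  change T.toSet ⊆ {x | ∃ s : ℕ → ℝ, (∀ j < n, 0 ≤ s j ∧ s j ≤ 1 / T.pathWeight j) ∧
      T.points 0 + ∑ j ∈ range n, s j • T.pathStep j = x}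
  refine convexHull_min ?_ ?_
  · rintro _ ⟨i, rfl⟩
    refine ⟨fun j => if j < i then (if (i : ℕ) ≤ T.tag then 1 else 1 / 2) else 0,
      fun j hj => ?_, ?_⟩
    · unfold pathWeight
      dsimp only
      split_ifs <;> first | omega | norm_num
    · rw [T.isPath_pathStep i, smul_sum, ← sum_subset (range_subset_range.2 i.is_le)]
      · congr 1
        refine sum_congr rfl fun j hj => ?_
        dsimp only
        rw [if_pos (mem_range.1 hj)]
      · intro j _ hj
        dsimp only
        rw [if_neg (mt mem_range.2 hj), zero_smul]
  · rintro _ ⟨s, hs, rfl⟩ _ ⟨t, ht, rfl⟩ a b ha hb hab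
    refine ⟨fun j => a * s j + b * t j, fun j hj => ⟨?_, ?_⟩, ?_⟩
    · have := (hs j hj).1
      have := (ht j hj).1
      positivity
    · calc a * s j + b * t j ≤ a * (1 / T.pathWeight j) + b * (1 / T.pathWeight j) :=
            add_le_add (mul_le_mul_of_nonneg_left (hs j hj).2 ha)
              (mul_le_mul_of_nonneg_left (ht j hj).2 hb)
        _ = 1 / T.pathWeight j := by rw [← add_mul, hab, one_mul]
    · simp only [add_smul, mul_smul, sum_add_distrib, ← smul_sum, smul_add]
      nth_rewrite 1 [← one_smul ℝ (T.points 0)]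
      rw [← hab]
      module

theorem stepBounds_pathStep {D ρ : ℝ} {c : EuclideanSpace ℝ (Fin n)}
    (hD : ∀ i j, ‖T.points i - T.points j‖ ≤ D) (hc : Metric.closedBall c ρ ⊆ T.toSet) :
    StepBounds n D ρ T.pathStep T.pathWeight where
  eq_one_or_two j _ := by unfold pathWeight; split_ifs <;> simp
  norm_le j _ := T.norm_pathStep_le hD j
  exists_coord u hu := by
    -- Half the difference of the coordinates of the antipodal points `c + u` and `c - u` represents
    -- `u`; this gains the factor 1/2 over the side of the parallelotope.
    obtain ⟨s, hs, hsu⟩ := T.exists_coord_of_mem_toSet (hc (show c + u ∈ _ by simpa using hu))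
    obtain ⟨t, ht, htu⟩ := T.exists_coord_of_mem_toSet (hc (show c - u ∈ _ by simpa using hu))
    refine ⟨fun j => (s j - t j) / 2, fun j hj => ?_, ?_⟩
    · have h1 := hs j hj
      have h2 := ht j hj
      have h3 : 1 / (2 * T.pathWeight j) = 1 / T.pathWeight j / 2 := by
        rw [div_div, mul_comm]
      rw [h3, abs_le]
      constructor <;> linarith
    · have h1 : ∑ j ∈ range n, ((s j - t j) / 2) • T.pathStep j =
          (1 / 2 : ℝ) • ((T.points 0 + ∑ j ∈ range n, s j • T.pathStep j) -
            (T.points 0 + ∑ j ∈ range n, t j • T.pathStep j)) := by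
        rw [add_sub_add_left_eq_sub, ← sum_sub_distrib, smul_sum]
        refine sum_congr rfl fun j _ => ?_
        module
      rw [h1, hsu, htu]
      module

end Initial

/-- The relative size of a step in a simplex with tag `g`. -/
noncomputable def stepSize (g j : ℕ) : ℝ := if j < g then 1 else 1 / 2

theorem stepSize_pos (g j : ℕ) : 0 < stepSize g j := by
  unfold stepSize; split_ifs <;> norm_num

/-! ### Balls around and inside a simplex in path form -/

section Bounds

variable {T : TaggedSimplex n} {w : EuclideanSpace ℝ (Fin n)} {h D ρ : ℝ}
  {d : ℕ → EuclideanSpace ℝ (Fin n)} {κ : ℕ → ℝ}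

/-- The `j`-th coordinate of a vertex lies in `[0, h * stepSize T.tag j]`; the centre of the ball is
the centre of this box. -/
theorem IsPath.toSet_subset_closedBall (H : T.IsPath w h d) (hh : 0 < h)
    (B : StepBounds n D ρ d κ) :
    T.toSet ⊆ Metric.closedBall (w + ∑ j ∈ range n, (h / 2 * stepSize T.tag j) • d j)
      (h / 2 * (∑ j ∈ range n, stepSize T.tag j * κ j) * D) := by
  refine convexHull_min ?_ (convex_closedBall _ _)
  rintro _ ⟨i, rfl⟩
  have hsum : (if (i : ℕ) ≤ T.tag then h else h / 2) • ∑ j ∈ range i, d j =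
      ∑ j ∈ range n, (if j < i then (if (i : ℕ) ≤ T.tag then h else h / 2) else 0) • d j := by
    rw [smul_sum, ← sum_subset (range_subset_range.2 i.is_le)]
    · refine sum_congr rfl fun j hj => ?_
      rw [if_pos (mem_range.1 hj)]
    · intro j _ hj
      rw [if_neg (by simpa using hj), zero_smul]
  rw [mem_closedBall_iff_norm, H, hsum, add_sub_add_left_eq_sub, ← sum_sub_distrib, mul_sum,
    sum_mul]
  refine norm_sum_le_of_le _ fun j hj => ?_
  rw [← sub_smul, norm_smul, Real.norm_eq_abs]
  calc _ ≤ h / 2 * stepSize T.tag j * (κ j * D) := by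
        refine mul_le_mul ?_ (B.norm_le j (mem_range.1 hj)) (norm_nonneg _)
          (mul_nonneg (by positivity) (stepSize_pos _ _).le)
        unfold stepSize
        rw [abs_le]
        split_ifs <;> first | omega | constructor <;> linarith
    _ = _ := by ring

/-- Summation by parts: it converts step coordinates into weights on the vertices. -/
theorem sum_sub_smul_partialSum {M : Type*} [AddCommGroup M] [Module ℝ M] (τ : ℕ → ℝ)
    (d : ℕ → M) (m : ℕ) :
    ∑ i ∈ range m, (τ i - τ (i + 1)) • ∑ j ∈ range (i + 1), d j =
      ∑ j ∈ range m, τ j • d j - τ m • ∑ j ∈ range m, d j := by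
  induction m with
  | zero => simp
  | succ m ih =>
    rw [sum_range_succ, ih, sum_range_succ d m, sum_range_succ (fun j => τ j • d j)]
    module

theorem sum_sub_div_stepSize (τ : ℕ → ℝ) {g m : ℕ} (hg : g ≤ m) :
    ∑ i ∈ range m, (τ i - τ (i + 1)) / stepSize g i = τ 0 + τ g - 2 * τ m := by
  induction m, hg using Nat.le_induction with
  | base =>
    have : ∀ i ∈ range g, (τ i - τ (i + 1)) / stepSize g i = τ i - τ (i + 1) := fun i hi => by
      rw [stepSize, if_pos (mem_range.1 hi), div_one]
    rw [sum_congr rfl this, sum_range_sub']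
    ring
  | succ m hm ih =>
    rw [sum_range_succ, ih, stepSize, if_neg (by omega)]
    ring

theorem sum_add_div_stepSize (τ : ℕ → ℝ) {g m : ℕ} (hg : g ≤ m) :
    ∑ i ∈ range m, (τ i + τ (i + 1)) / stepSize g i =
      2 * ∑ i ∈ range m, τ i / stepSize g i + 2 * τ m - τ 0 - τ g := by
  induction m, hg using Nat.le_induction with
  | base =>
    have h1 : ∀ i ∈ range g, (τ i + τ (i + 1)) / stepSize g i = τ i + τ (i + 1) :=
      fun i hi => by rw [stepSize, if_pos (mem_range.1 hi), div_one]
    have h2 : ∀ i ∈ range g, τ i / stepSize g i = τ i :=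
      fun i hi => by rw [stepSize, if_pos (mem_range.1 hi), div_one]
    have h3 := sum_range_succ τ g
    rw [sum_range_succ'] at h3
    rw [sum_congr rfl h1, sum_congr rfl h2, sum_add_distrib]
    linarith
  | succ m hm ih =>
    rw [sum_range_succ, ih, sum_range_succ, stepSize, if_neg (by omega)]
    ring

/-- The change of barycentric coordinates in a simplex with tag `g` along the vector with
coordinates `τ` with respect to the steps. -/
noncomputable def baryChange (g : ℕ) (τ : ℕ → ℝ) : ℕ → ℝ
  | 0 => -τ 0 - τ g
  | i + 1 => (τ i - τ (i + 1)) / stepSize g i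

/-- The bound on `baryChange` for coordinates bounded by `μ`. -/
noncomputable def baryBound (g : ℕ) (μ : ℕ → ℝ) : ℕ → ℝ
  | 0 => μ 0 + μ g
  | i + 1 => (μ i + μ (i + 1)) / stepSize g i

theorem abs_baryChange_le {g : ℕ} {τ μ : ℕ → ℝ} (hτ : ∀ j, |τ j| ≤ μ j) (i : ℕ) :
    |baryChange g τ i| ≤ baryBound g μ i := by
  cases i with
  | zero =>
    have h1 := abs_le.1 (hτ 0)
    have h2 := abs_le.1 (hτ g)
    rw [baryChange, baryBound, abs_le]
    constructor <;> linarith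
  | succ i =>
    rw [baryChange, baryBound, abs_div, abs_of_pos (stepSize_pos g i)]
    refine div_le_div_of_nonneg_right ?_ (stepSize_pos g i).le
    exact (abs_sub _ _).trans (add_le_add (hτ _) (hτ _))

theorem sum_baryChange {g m : ℕ} {τ : ℕ → ℝ} (hg : g ≤ m) (hτ : τ m = 0) :
    ∑ i ∈ range (m + 1), baryChange g τ i = 0 := by
  rw [sum_range_succ']
  simp only [baryChange]
  rw [sum_sub_div_stepSize τ hg, hτ]
  ring

theorem sum_baryBound {g m : ℕ} {μ : ℕ → ℝ} (hg : g ≤ m) (hμ : μ m = 0) :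
    ∑ i ∈ range (m + 1), baryBound g μ i = 2 * ∑ i ∈ range m, μ i / stepSize g i := by
  rw [sum_range_succ']
  simp only [baryBound]
  rw [sum_add_div_stepSize μ hg, hμ]
  ring

theorem IsPath.sum_baryChange_smul (H : T.IsPath w h d) {τ : ℕ → ℝ} (hτ : τ n = 0) :
    ∑ i : Fin (n + 1), baryChange T.tag τ i • T.points i =
      h • ∑ j ∈ range n, τ j • d j := by
  have h0 : ∑ i : Fin (n + 1), baryChange T.tag τ i • T.points i =
      ∑ i ∈ range (n + 1), baryChange T.tag τ i •
        (w + (if i ≤ T.tag then h else h / 2) • ∑ j ∈ range i, d j) := by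
    rw [sum_range]
    exact sum_congr rfl fun i _ => by rw [H i]
  simp only [h0, smul_add, sum_add_distrib, ← sum_smul, sum_baryChange T.tag_le hτ, zero_smul,
    zero_add]
  rw [sum_range_succ']
  simp only [range_zero, sum_empty, smul_zero, add_zero]
  have h1 : ∀ i ∈ range n, baryChange T.tag τ (i + 1) •
      (if i + 1 ≤ T.tag then h else h / 2) • ∑ j ∈ range (i + 1), d j =
      h • (τ i - τ (i + 1)) • ∑ j ∈ range (i + 1), d j := by
    intro i _
    rw [smul_smul, smul_smul]
    congr 1
    rw [baryChange, stepSize]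
    split_ifs <;> first | omega | ring
  rw [sum_congr rfl h1, ← smul_sum, sum_sub_smul_partialSum, hτ, zero_smul, sub_zero]

/-- The centre gets as barycentric coordinates the largest changes that a vector of the ball can
cause, so none becomes negative. The radius is what makes these bounds sum to 1. -/
theorem IsPath.exists_closedBall_subset_toSet (H : T.IsPath w h d) (hh : 0 < h)
    (B : StepBounds n D ρ d κ) :
    ∃ c, Metric.closedBall c (ρ * h / ∑ j ∈ range n, 1 / (stepSize T.tag j * κ j)) ⊆
      T.toSet := by
  set S : ℝ := ∑ j ∈ range n, 1 / (stepSize T.tag j * κ j) with hS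
  have hκ : ∀ j < n, 0 < κ j := fun j hj => by
    rcases B.eq_one_or_two j hj with e | e <;> rw [e] <;> norm_num
  have hSpos : 0 < S := by
    refine sum_pos (fun j hj => ?_) ⟨0, mem_range.2 (T.one_le_tag.trans T.tag_le)⟩
    have := hκ j (mem_range.1 hj)
    have := stepSize_pos T.tag j
    positivity
  -- The value 0 at `n` matters: the last vertex has only one adjacent step, yet its weight involves
  -- `μ n`.
  set μ : ℕ → ℝ := fun j => if j < n then 1 / (2 * κ j) / S else 0 with hμ
  have hμn : μ n = 0 := by simp [hμ]
  have hone : ∑ i : Fin (n + 1), baryBound T.tag μ i = 1 := by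
    rw [← sum_range, sum_baryBound T.tag_le hμn, mul_sum]
    have : ∀ j ∈ range n, 2 * (μ j / stepSize T.tag j) =
        1 / (stepSize T.tag j * κ j) / S := by
      intro j hj
      have h1 := (hκ j (mem_range.1 hj)).ne'
      have h2 := (stepSize_pos T.tag j).ne'
      simp only [hμ, if_pos (mem_range.1 hj)]
      field_simp
    rw [sum_congr rfl this, ← sum_div, ← hS, div_self hSpos.ne']
  refine ⟨∑ i : Fin (n + 1), baryBound T.tag μ i • T.points i, fun x hx => ?_⟩
  obtain ⟨u, rfl⟩ : ∃ u, x = ∑ i : Fin (n + 1), baryBound T.tag μ i • T.points i + u :=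
    ⟨_, (add_sub_cancel _ _).symm⟩
  have hu : ‖u‖ ≤ ρ * h / S := by simpa using hx
  obtain ⟨t, ht, htu⟩ := B.exists_coord ((S / h) • u) (by
    rw [norm_smul, Real.norm_of_nonneg (by positivity)]
    calc S / h * ‖u‖ ≤ S / h * (ρ * h / S) := by gcongr
      _ = ρ := by field_simp)
  set τ : ℕ → ℝ := fun j => if j < n then t j / S else 0 with hτ
  have hτn : τ n = 0 := by simp [hτ]
  have hτμ : ∀ j, |τ j| ≤ μ j := fun j => by
    simp only [hτ, hμ]
    split_ifs with hj
    · rw [abs_div, abs_of_pos hSpos]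
      exact div_le_div_of_nonneg_right (ht j hj) hSpos.le
    · simp
  have hτu : ∑ i : Fin (n + 1), baryChange T.tag τ i • T.points i = u := by
    rw [H.sum_baryChange_smul hτn]
    have : ∀ j ∈ range n, τ j • d j = S⁻¹ • t j • d j := fun j hj => by
      simp only [hτ, if_pos (mem_range.1 hj), smul_smul, div_eq_inv_mul]
    rw [sum_congr rfl this, ← smul_sum, htu, smul_smul, smul_smul]
    convert one_smul ℝ u using 2
    field_simp
  rw [← hτu, ← sum_add_distrib]
  simp only [← add_smul]
  refine (convex_convexHull ℝ _).sum_mem (fun i _ => ?_) ?_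
    fun i _ => subset_convexHull ℝ _ (Set.mem_range_self i)
  · have := (abs_le.1 (abs_baryChange_le (g := T.tag) hτμ i)).1
    linarith
  · rw [sum_add_distrib, hone, ← sum_range, sum_baryChange T.tag_le hτn, add_zero]

end Bounds

/-! ### The numerical constant -/

/-- AM-GM for the two sums, with `z + 1 / z ≤ 5 / 2` termwise. -/
theorem sum_mul_sum_inv_le {z : ℕ → ℝ} (n : ℕ)
    (hz : ∀ j < n, z j = 1 / 2 ∨ z j = 1 ∨ z j = 2) :
    (∑ j ∈ range n, z j) * ∑ j ∈ range n, 1 / z j ≤ 25 / 16 * (n : ℝ) ^ 2 := by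
  have h0 : 0 ≤ ∑ j ∈ range n, z j + ∑ j ∈ range n, 1 / z j := by
    rw [← sum_add_distrib]
    refine sum_nonneg fun j hj => ?_
    rcases hz j (mem_range.1 hj) with e | e | e <;> rw [e] <;> norm_num
  have h1 : ∑ j ∈ range n, z j + ∑ j ∈ range n, 1 / z j ≤ n * (5 / 2 : ℝ) := by
    rw [← sum_add_distrib]
    refine (sum_le_card_nsmul _ _ (5 / 2 : ℝ) fun j hj => ?_).trans_eq (by simp)
    rcases hz j (mem_range.1 hj) with e | e | e <;> rw [e] <;> norm_num
  nlinarith [sq_nonneg (∑ j ∈ range n, z j - ∑ j ∈ range n, 1 / z j), pow_le_pow_left₀ h0 h1 2]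

/-! ### Inscribed and circumscribed diameters -/

section Diameters

variable (T : TaggedSimplex n)

theorem isBounded_toSet : Bornology.IsBounded T.toSet :=
  isBounded_convexHull.2 (Set.finite_range _).isBounded

theorem bddAbove_inballDiam : BddAbove {d : ℝ | ∃ (c : EuclideanSpace ℝ (Fin n)) (ρ : ℝ),
    0 ≤ ρ ∧ Metric.closedBall c ρ ⊆ T.toSet ∧ d = 2 * ρ} := by
  refine ⟨Metric.diam T.toSet, ?_⟩
  rintro _ ⟨c, ρ, hρ, hc, rfl⟩
  -- Positive dimension provides two antipodal points of the ball, at distance `2 * ρ`.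
  have : Nonempty (Fin n) := ⟨⟨0, T.one_le_tag.trans T.tag_le⟩⟩
  obtain ⟨u, hu⟩ := exists_norm_eq (EuclideanSpace ℝ (Fin n)) hρ
  have h1 := Metric.dist_le_diam_of_mem T.isBounded_toSet
    (hc (show c + u ∈ _ by simp [hu])) (hc (show c - u ∈ _ by simp [hu]))
  have h2 : dist (c + u) (c - u) = 2 * ρ := by
    rw [dist_eq_norm, show c + u - (c - u) = (2 : ℝ) • u by module, norm_smul, hu,
      Real.norm_two]
  rwa [h2] at h1

theorem le_inballDiam {c : EuclideanSpace ℝ (Fin n)} {ρ : ℝ} (hρ : 0 ≤ ρ)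
    (hc : Metric.closedBall c ρ ⊆ T.toSet) : 2 * ρ ≤ inballDiam T.toSet :=
  le_csSup T.bddAbove_inballDiam ⟨c, ρ, hρ, hc, rfl⟩

theorem inballDiam_pos : 0 < inballDiam T.toSet := by
  have hspan : affineSpan ℝ (Set.range T.points) = ⊤ :=
    T.independent.affineSpan_eq_top_iff_card_eq_finrank_add_one.2 (by simp)
  obtain ⟨c, hc⟩ := interior_convexHull_nonempty_iff_affineSpan_eq_top.2 hspan
  obtain ⟨ρ, hρ, hcρ⟩ := Metric.nhds_basis_closedBall.mem_iff.1 (mem_interior_iff_mem_nhds.1 hc)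
  have := T.le_inballDiam hρ.le hcρ
  linarith

theorem circumballDiam_le {c : EuclideanSpace ℝ (Fin n)} {ρ : ℝ} (hρ : 0 ≤ ρ)
    (hc : T.toSet ⊆ Metric.closedBall c ρ) : circumballDiam T.toSet ≤ 2 * ρ := by
  refine csInf_le ⟨0, ?_⟩ ⟨c, ρ, hρ, hc, rfl⟩
  rintro _ ⟨_, σ, hσ, _, rfl⟩
  positivity

theorem circumballDiam_nonneg : 0 ≤ circumballDiam T.toSet := by
  refine Real.sInf_nonneg ?_
  rintro _ ⟨_, σ, hσ, _, rfl⟩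
  positivity

theorem norm_points_sub_le (i j : Fin (n + 1)) :
    ‖T.points i - T.points j‖ ≤ circumballDiam T.toSet := by
  refine le_csInf ?_ ?_
  · obtain ⟨ρ, hρ⟩ := T.isBounded_toSet.subset_closedBall (0 : EuclideanSpace ℝ (Fin n))
    exact ⟨_, 0, max ρ 0, le_max_right _ _,
      hρ.trans (Metric.closedBall_subset_closedBall (le_max_left _ _)), rfl⟩
  · rintro _ ⟨c, σ, _, hc, rfl⟩
    have hi := hc (subset_convexHull ℝ _ (Set.mem_range_self i))
    have hj := hc (subset_convexHull ℝ _ (Set.mem_range_self j))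
    rw [← dist_eq_norm]
    rw [Metric.mem_closedBall] at hi hj
    exact (dist_triangle_right _ _ c).trans ((add_le_add hi hj).trans_eq (two_mul σ).symm)

end Diameters

/-! ### Comparison of a descendant with the initial simplex -/

theorem IsDescendant.circumballDiam_mul_le {T₀ T : TaggedSimplex n} (hT : IsDescendant T₀ T)
    {c : EuclideanSpace ℝ (Fin n)} {ρ : ℝ} (hρ : 0 ≤ ρ)
    (hc : Metric.closedBall c ρ ⊆ T₀.toSet) :
    circumballDiam T.toSet * (2 * ρ) ≤
      25 / 16 * (n : ℝ) ^ 2 * circumballDiam T₀.toSet * inballDiam T.toSet := by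
  obtain ⟨w, h, d, κ, hh, H, B⟩ := hT.exists_isPath one_pos T₀.isPath_pathStep
    (T₀.stepBounds_pathStep T₀.norm_points_sub_le hc)
  have hD := T₀.circumballDiam_nonneg
  set D := circumballDiam T₀.toSet
  have hz : ∀ j < n, stepSize T.tag j * κ j = 1 / 2 ∨ stepSize T.tag j * κ j = 1 ∨
      stepSize T.tag j * κ j = 2 := fun j hj => by
    unfold stepSize
    rcases B.eq_one_or_two j hj with e | e <;> rw [e] <;> split_ifs <;> norm_num
  have hzpos : ∀ j ∈ range n, 0 < stepSize T.tag j * κ j := fun j hj => by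
    rcases hz j (mem_range.1 hj) with e | e | e <;> rw [e] <;> norm_num
  have hne : (range n).Nonempty := ⟨0, mem_range.2 (T.one_le_tag.trans T.tag_le)⟩
  have hA : 0 < ∑ j ∈ range n, stepSize T.tag j * κ j := sum_pos hzpos hne
  have hS : 0 < ∑ j ∈ range n, 1 / (stepSize T.tag j * κ j) :=
    sum_pos (fun j hj => one_div_pos.2 (hzpos j hj)) hne
  have hAS := sum_mul_sum_inv_le n hz
  obtain ⟨c', hc'⟩ := H.exists_closedBall_subset_toSet hh B
  have hR := T.circumballDiam_le (by positivity) (H.toSet_subset_closedBall hh B)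
  have hr := T.le_inballDiam (by positivity) hc'
  set A := ∑ j ∈ range n, stepSize T.tag j * κ j
  set S := ∑ j ∈ range n, 1 / (stepSize T.tag j * κ j)
  calc circumballDiam T.toSet * (2 * ρ) ≤ 2 * (h / 2 * A * D) * (2 * ρ) := by gcongr
    _ = A * S * D * (2 * (ρ * h / S)) := by field_simp
    _ ≤ 25 / 16 * (n : ℝ) ^ 2 * D * inballDiam T.toSet := by gcongr

theorem IsDescendant.circumballDiam_mul_inballDiam_le {T₀ T : TaggedSimplex n}
    (hT : IsDescendant T₀ T) :
    circumballDiam T.toSet * inballDiam T₀.toSet ≤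
      25 / 16 * (n : ℝ) ^ 2 * circumballDiam T₀.toSet * inballDiam T.toSet := by
  have h0 := T₀.circumballDiam_nonneg
  have hr := T.inballDiam_pos
  rcases T.circumballDiam_nonneg.eq_or_lt with h | h
  · rw [← h, zero_mul]
    positivity
  -- Isolating `inballDiam T₀.toSet` allows passing to the supremum over the balls in `T₀`.
  · rw [mul_comm, ← le_div_iff₀ h]
    refine Real.sSup_le ?_ (by positivity)
    rintro _ ⟨c, ρ, hρ, hc, rfl⟩
    rw [le_div_iff₀ h, mul_comm]
    exact hT.circumballDiam_mul_le hρ hc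

end TaggedSimplex

end Maubach

theorem mainTheorem4 (n : ℕ) (T₀ T : Maubach.TaggedSimplex n)
    (hT : Maubach.TaggedSimplex.IsDescendant T₀ T) :
    Maubach.shapeRegularity T.toSet ≤
      2 * (n : ℝ) * ((n : ℝ) + Real.sqrt 2 - 1) * Maubach.shapeRegularity T₀.toSet := by
  have h0 := T₀.circumballDiam_nonneg
  have hr₀ := T₀.inballDiam_pos
  have hr := T.inballDiam_pos
  have hsqrt : 1 ≤ Real.sqrt 2 := Real.one_le_sqrt.2 one_le_two
  have hn : (0 : ℝ) ≤ n := n.cast_nonneg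
  have hconst : 25 / 16 * (n : ℝ) ^ 2 ≤ 2 * (n : ℝ) * ((n : ℝ) + Real.sqrt 2 - 1) := by
    nlinarith [mul_nonneg hn (sub_nonneg.2 hsqrt), sq_nonneg (n : ℝ)]
  unfold Maubach.shapeRegularity
  rw [← mul_div_assoc, div_le_div_iff₀ hr hr₀]
  refine hT.circumballDiam_mul_inballDiam_le.trans ?_
  gcongr
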